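/- Let $G$ be a nontrivial finite nilpotent group of nilpotency class at most $2$. The Cayley machine $\mathcal C(G)$ is the automaton with state set $G$ and alphabet $G$ which, at state $g$ on input $a$, goes to state $ga$ and outputs $ga$. Started in state $g$, it defines a permutation $\mathcal C_g$ of the set $G^{\omega}$ of right-infinite words over $G$, namely $\mathcal C_g(a_1a_2a_3\cdots)=(ga_1)(ga_1a_2)(ga_1a_2a_3)\cdots$. Let $\mathcal G(\mathcal C(G))=\langle \mathcal C_g : g\in G\rangle$ be the automata group generated by $\mathcal C(G)$, a group of permutations of $G^\omega$. Then $\mathcal G(\mathcal C(G))$ is a cross-wired lamplighter group, i.e. it is isomorphic to a cocompact lattice in the isometry group of a Diestel–Leader graph: there are an integer $q\ge 2$ and a faithful, proper and cocompact action of the discrete group $\mathcal G(\mathcal C(G))$ by isometries (graph automorphisms) on the Diestel–Leader graph $\mathrm{DL}(q,q)$. Here $\mathrm{DL}(q,q)$ is defined as follows. Let $T$ be the $(q+1)$-regular tree with a Busemann function $\mathfrak h:T\to\mathbb Z$ with respect to a fixed end. The vertices of $\mathrm{DL}(q,q)$ are the pairs $(u,v)$ of vertices of $T$ with $\mathfrak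 h(u)+\mathfrak h(v)=0$, and $(u,v)$, $(u',v')$ are adjacent if and only if $u,u'$ are adjacent and $v,v'$ are adjacent in $T$. -/

import Mathlib

/-- An invertible letter-to-letter (Mealy) automaton with state set `Q` and alphabet `A`: in state
`q`, on input `a`, it outputs `out q a` and moves to the state `next q a`, and every `out q` is a
permutation of the alphabet. -/
structure InvertibleAutomaton (Q A : Type*) where
  next : Q → A → Q
  out : Q → Equiv.Perm A

namespace InvertibleAutomaton

variable {Q A : Type*}

/-- The state reached from `q` after reading the first `n` letters of the infinite word `w`. -/
def stateAt (M : InvertibleAutomaton Q A) (q : Q) (w : ℕ → A) : ℕ → Q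
  | 0 => q
  | n + 1 => M.next (M.stateAt q w n) (w n)

/-- The transformation of right-infinite words computed by the automaton started in state `q`. -/
def transform (M : InvertibleAutomaton Q A) (q : Q) (w : ℕ → A) : ℕ → A :=
  fun n => M.out (M.stateAt q w n) (w n)

/-- The inverse automaton, obtained by exchanging inputs and outputs. -/
def inverse (M : InvertibleAutomaton Q A) : InvertibleAutomaton Q A where
  next q b := M.next q ((M.out q).symm b)
  out q := (M.out q).symm

theorem stateAt_inverse_transform (M : InvertibleAutomaton Q A) (q : Q) (w : ℕ → A) (n : ℕ) :
    M.inverse.stateAt q (M.transform q w) n = M.stateAt q w n := by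
  induction n with
  | zero => rfl
  | succ n ih =>
    rw [stateAt, ih]
    simp [stateAt, inverse, transform]

theorem inverse_transform_transform (M : InvertibleAutomaton Q A) (q : Q) (w : ℕ → A) :
    M.inverse.transform q (M.transform q w) = w := by
  funext n
  have h := M.stateAt_inverse_transform q w n
  simp only [transform] at h ⊢
  rw [h]
  simp [inverse]

theorem inverse_inverse (M : InvertibleAutomaton Q A) : M.inverse.inverse = M := by
  simp [inverse]

/-- The permutation of the set of right-infinite words defined by the state `q`. -/
def statePerm (M : InvertibleAutomaton Q A) (q : Q) : Equiv.Perm (ℕ → A) where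
  toFun := M.transform q
  invFun := M.inverse.transform q
  left_inv := M.inverse_transform_transform q
  right_inv w := by
    have h := M.inverse.inverse_transform_transform q w
    rwa [M.inverse_inverse] at h

/-- The automata group: the group of permutations of the right-infinite words generated by the
transformations defined by the states. -/
def automataGroup (M : InvertibleAutomaton Q A) : Subgroup (Equiv.Perm (ℕ → A)) :=
  Subgroup.closure (Set.range M.statePerm)

end InvertibleAutomaton

/-- The Cayley machine of a group `G`: states and alphabet are `G`, and at state `g` on input `a`
the machine goes to state `g * a` and outputs `g * a`. -/
def cayleyMachine (G : Type*) [Group G] : InvertibleAutomaton G G where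
  next g a := g * a
  out g := Equiv.mulLeft g

/-- The vertices of the `(q + 1)`-regular tree, arranged in horocycles with respect to a fixed end.
A vertex on the horocycle `level` is a sequence `(label i)`, `i ≤ level`, of elements of
`{0, …, q - 1}` which vanishes for `i` close to `-∞` (it is extended by `0` to `i > level`). -/
@[ext]
structure HoroVertex (q : ℕ) where
  level : ℤ
  label : ℤ → ℕ
  label_lt : ∀ i, label i < q
  label_above : ∀ i, level < i → label i = 0
  label_below : ∃ m : ℤ, ∀ i, i < m → label i = 0

/-- The predecessor of a vertex, i.e. its neighbour in the direction of the fixed end: delete the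
last letter of the sequence. Every vertex is the predecessor of exactly `q` vertices. -/
def HoroVertex.pred {q : ℕ} (v : HoroVertex q) : HoroVertex q where
  level := v.level - 1
  label := fun i => if i < v.level then v.label i else 0
  label_lt i := by
    split
    · exact v.label_lt i
    · exact lt_of_le_of_lt (Nat.zero_le _) (v.label_lt i)
  label_above i hi := by
    rw [if_neg (by omega)]
  label_below := by
    obtain ⟨m, hm⟩ := v.label_below
    exact ⟨m, fun i hi => by simp [hm i hi]⟩

/-- The `(q + 1)`-regular tree. The function `HoroVertex.level` is its Busemann function with
respect to the fixed end (increasing in the direction away from the end). -/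
def regularTree (q : ℕ) : SimpleGraph (HoroVertex q) where
  Adj v w := v.pred = w ∨ w.pred = v
  symm := ⟨fun _ _ h => h.symm⟩
  loopless := ⟨fun v h => by
    have h' : v.pred.level = v.level := congrArg HoroVertex.level (h.elim id id)
    simp [HoroVertex.pred] at h'⟩

/-- The vertices of the Diestel–Leader graph `DL(p, q)`: pairs of vertices of the `(p + 1)`-regular
and the `(q + 1)`-regular tree whose Busemann functions add up to `0`. -/
def DLVertex (p q : ℕ) : Type :=
  {v : HoroVertex p × HoroVertex q // v.1.level + v.2.level = 0}

/-- The Diestel–Leader graph `DL(p, q)`: two vertices are adjacent if and only if both of their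
coordinates are adjacent in the respective trees. -/
def diestelLeader (p q : ℕ) : SimpleGraph (DLVertex p q) where
  Adj v w := (regularTree p).Adj v.1.1 w.1.1 ∧ (regularTree q).Adj v.1.2 w.1.2
  symm := ⟨fun _ _ h => ⟨h.1.symm, h.2.symm⟩⟩
  loopless := ⟨fun v h => (regularTree p).loopless.irrefl v.1.1 h.1⟩

section Actions

variable {Γ V : Type*} [Group Γ] {X : SimpleGraph V}

/-- An action of a discrete group by automorphisms (isometries) of a graph is proper if, for every
compact, i.e. finite, set `K` of vertices, only finitely many group elements move `K` to a set which
meets `K`. -/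
def IsProperGraphAction (φ : Γ →* (X ≃g X)) : Prop :=
  ∀ K : Set V, K.Finite → {γ : Γ | ((fun v => φ γ v) '' K ∩ K).Nonempty}.Finite

/-- An action by automorphisms of a graph is cocompact if the translates of some finite set of
vertices cover the vertex set. -/
def IsCocompactGraphAction (φ : Γ →* (X ≃g X)) : Prop :=
  ∃ K : Set V, K.Finite ∧ ∀ v : V, ∃ γ : Γ, ∃ u ∈ K, φ γ u = v

end Actions

/-- A group is a cross-wired lamplighter group if it is isomorphic to a cocompact lattice in the
isometry group of a Diestel–Leader graph `DL(q, q)`, `q ≥ 2`; that is, if it acts faithfully,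
properly and cocompactly by isometries on `DL(q, q)`. -/
def IsCrossWiredLamplighter (Γ : Type*) [Group Γ] : Prop :=
  ∃ q : ℕ, 2 ≤ q ∧ ∃ φ : Γ →* (diestelLeader q q ≃g diestelLeader q q),
    Function.Injective φ ∧ IsProperGraphAction φ ∧ IsCocompactGraphAction φ

/-! Write `t` for `partialProd G`, the transformation of state `1`. Since `C_g` is `t` after
multiplying the first letter by `g`, the automata group is generated by `t` and the lamps `lamp k
g`, the conjugates of these multiplications by `t ^ k`. The lamps generate a normal subgroup `N`,
and the group is `N ⋊ ⟨t⟩`; the exponent of `t` is the level. Let `A` and `B` be generated by the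
lamps of index `≥ 0` and `< 0`. Conjugation by `t` raises indices by one, so `t` contracts `A` and
`t⁻¹` contracts `B`, in each case with index `|G|`. The cosets of `A` and of `B` are then the
vertices of two `(|G| + 1)`-regular trees with opposite level functions. The pair of base cosets has
stabilizer `A ∩ B`, and the action on the Diestel–Leader graph is transitive when `N = A B`. So it
suffices to prove `A ∩ B = 1` and `N = A B` (`isCrossWiredLamplighter_of_complement`).

Class two gives this through commutators. A lamp of index `-d` is a central twist of a translation,
so its commutator with a lamp of index `0` is translation by a central word supported on the letters
`0, …, d`, hence a product of central lamps with indices in `[-d, 0]`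
(`lamp_commutator_mem_lampSubgroup`). Central lamps commute with all lamps, so lamps can be sorted
by index (`exists_mul_of_mem_lampSubgroup`). Uniqueness holds because a lamp of index `-d` visibly
changes letter `d`, which lamps with indices in `(-d, 0]` fix (`eq_one_of_lamp_mem_Ioi`). -/

/-! ### Trees from coset spaces and the Diestel–Leader action. -/

/-- A set with a level function and a predecessor map all of whose fibres have `q` elements, and in
which every predecessor ray merges with a fixed bi-infinite ray, is the vertex set of the
`(q + 1)`-regular tree. -/
theorem exists_equiv_horoVertex {X : Type*} {q : ℕ} (hq : 0 < q) (lvl : X → ℤ) (pr : X → X)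
    (hlvl : ∀ x, lvl (pr x) = lvl x - 1) (hcard : ∀ x, Nat.card {y // pr y = x} = q)
    (o : ℤ → X) (ho : ∀ n, lvl (o n) = n) (hpo : ∀ n, pr (o n) = o (n - 1))
    (htail : ∀ x, ∃ k : ℕ, pr^[k] x = o (lvl x - k)) :
    ∃ e : X ≃ HoroVertex q, (∀ x, (e x).level = lvl x) ∧ ∀ x, (e x).pred = e (pr x) := by
  classical
  -- The levels of the `o n` are distinct, so a fibre contains at most one of them, and a swap gives
  -- it the label `0`. Labels read along a predecessor ray are then eventually `0`.
  have hfib : ∀ x, ∃ e : {y // pr y = x} ≃ Fin q, ∀ n (h : pr (o n) = x),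
      e ⟨o n, h⟩ = ⟨0, hq⟩ := by
    intro x
    have : Finite {y // pr y = x} := Nat.finite_of_card_ne_zero (by rw [hcard]; omega)
    let e₀ : {y // pr y = x} ≃ Fin q := Finite.equivFinOfCardEq (hcard x)
    by_cases hx : ∃ n, pr (o n) = x
    · obtain ⟨m, hm⟩ := hx
      refine ⟨e₀.trans (Equiv.swap (e₀ ⟨o m, hm⟩) ⟨0, hq⟩), fun n h => ?_⟩
      have hnm : n = m := by
        have := congrArg lvl (h.trans hm.symm)
        rw [hlvl, hlvl, ho, ho] at this
        omega
      subst hnm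
      simp
    · exact ⟨e₀, fun n h => (hx ⟨n, h⟩).elim⟩
  choose fe hfe using hfib
  let lab : X → ℕ := fun y => fe (pr y) ⟨y, rfl⟩
  have hlab_lt : ∀ y, lab y < q := fun y => (fe (pr y) ⟨y, rfl⟩).2
  have hlab_o : ∀ n, lab (o n) = 0 := fun n => congrArg Fin.val (hfe _ n rfl)
  have hlab_eq : ∀ x y (h : pr y = x), lab y = fe x ⟨y, h⟩ := by
    rintro _ y rfl
    rfl
  have hinj : ∀ y z, pr y = pr z → lab y = lab z → y = z := by
    intro y z h hl
    rw [hlab_eq (pr z) y h] at hl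
    exact congrArg Subtype.val ((fe (pr z)).injective (Fin.ext hl))
  have hsurj : ∀ x i, i < q → ∃ y, pr y = x ∧ lab y = i := by
    intro x i hi
    refine ⟨(fe x).symm ⟨i, hi⟩, ((fe x).symm ⟨i, hi⟩).2, ?_⟩
    rw [hlab_eq x _ ((fe x).symm ⟨i, hi⟩).2]
    simp
  have hiter_o : ∀ (k : ℕ) n, pr^[k] (o n) = o (n - k) := by
    intro k
    induction k with
    | zero => intro n; simp
    | succ k ih =>
      intro n
      rw [Function.iterate_succ_apply, hpo, ih]
      congr 1
      push_cast
      ring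
  have htail' : ∀ x, ∃ k : ℕ, ∀ j : ℕ, k ≤ j → pr^[j] x = o (lvl x - j) := by
    intro x
    obtain ⟨k, hk⟩ := htail x
    refine ⟨k, fun j hj => ?_⟩
    obtain ⟨i, rfl⟩ := Nat.exists_eq_add_of_le hj
    rw [add_comm k i, Function.iterate_add_apply, hk, hiter_o]
    congr 1
    push_cast
    ring
  let E : X → HoroVertex q := fun x =>
    { level := lvl x
      label := fun i => if i ≤ lvl x then lab (pr^[(lvl x - i).toNat] x) else 0
      label_lt := fun i => by
        split
        · exact hlab_lt _
        · exact hq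
      label_above := fun i hi => if_neg (by omega)
      label_below := by
        obtain ⟨k, hk⟩ := htail' x
        refine ⟨lvl x - k, fun i hi => ?_⟩
        rw [if_pos (by omega), hk _ (by omega), hlab_o] }
  have hE : ∀ x i, (E x).label i = if i ≤ lvl x then lab (pr^[(lvl x - i).toNat] x) else 0 :=
    fun _ _ => rfl
  have hpred : ∀ x, (E x).pred = E (pr x) := by
    intro x
    ext i
    · exact (hlvl x).symm
    · change (if i < lvl x then (E x).label i else 0) = (E (pr x)).label i
      rw [hE, hE, hlvl]
      by_cases hi : i < lvl x
      · rw [if_pos hi, if_pos (by omega), if_pos (by omega), ← Function.iterate_succ_apply]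
        congr 2
        omega
      · rw [if_neg hi, if_neg (by omega)]
  have hEinj : Function.Injective E := by
    intro x y hxy
    have hl : lvl x = lvl y := congrArg HoroVertex.level hxy
    obtain ⟨k, hk⟩ := htail' x
    obtain ⟨k', hk'⟩ := htail' y
    -- Both rays end on `o`, so they meet; equal labels then propagate equality back from ancestors
    -- to children.
    have key : ∀ j : ℕ, pr^[j] x = pr^[j] y → x = y := by
      intro j
      induction j with
      | zero => exact id
      | succ j ih =>
        intro h
        refine ih (hinj _ _ ?_ ?_)
        · rwa [← Function.iterate_succ_apply' pr j x, ← Function.iterate_succ_apply' pr j y]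
        · have h2 := congrArg (fun v => HoroVertex.label v (lvl x - j)) hxy
          simp only [hE] at h2
          rw [← hl, if_pos (by omega), if_pos (by omega)] at h2
          simpa using h2
    refine key (max k k') ?_
    rw [hk _ (le_max_left _ _), hk' _ (le_max_right _ _), hl]
  have hEo : ∀ n i, (E (o n)).label i = 0 := by
    intro n i
    rw [hE]
    split
    · rw [hiter_o, hlab_o]
    · rfl
  -- Induction on the number `d` of top labels that may be nonzero; for `d = 0` the vertex lies on
  -- the fixed ray.
  have hEsurj : ∀ (d : ℕ) (v : HoroVertex q), (∀ i, i ≤ v.level - d → v.label i = 0) →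
      ∃ x, E x = v := by
    intro d
    induction d with
    | zero =>
      intro v hv
      refine ⟨o v.level, ?_⟩
      ext i
      · exact ho _
      · rw [hEo]
        rcases le_or_gt i v.level with h | h
        · exact (hv i (by simpa using h)).symm
        · exact (v.label_above i h).symm
    | succ d ih =>
      intro v hv
      obtain ⟨x, hx⟩ := ih v.pred (by
        intro i hi
        change (if i < v.level then v.label i else 0) = 0
        change i ≤ v.level - 1 - d at hi
        split
        · exact hv i (by push_cast; omega)
        · rfl)
      obtain ⟨y, hy, hly⟩ := hsurj x (v.label v.level) (v.label_lt _)
      have hlx : lvl x = v.level - 1 := congrArg HoroVertex.level hx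
      have hly' : lvl y = v.level := by
        have := hlvl y
        rw [hy] at this
        omega
      refine ⟨y, ?_⟩
      ext i
      · exact hly'
      · rcases lt_trichotomy i v.level with h | h | h
        · have h1 := congrArg (fun v => HoroVertex.label v i) ((hpred y).trans (by rw [hy, hx]))
          change (if i < lvl y then (E y).label i else 0) = if i < v.level then v.label i else 0 at h1
          rwa [if_pos (by omega), if_pos h] at h1
        · subst h
          rw [hE, hly', if_pos le_rfl]
          simpa using hly
        · rw [v.label_above i h, (E y).label_above i (by change lvl y < i; omega)]
  refine ⟨Equiv.ofBijective E ⟨hEinj, fun v => ?_⟩, fun x => rfl, hpred⟩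
  obtain ⟨m, hm⟩ := v.label_below
  exact hEsurj (v.level - m + 1).toNat v fun i hi => hm i (by omega)

/-- The coset tree: if `τ` contracts the subgroup `A` of the kernel of `lev`, with transversal
`s : G → A`, and every element of the kernel is contracted into `A`, then the group acts on the
regular tree, transitively and with `A` as a vertex stabilizer, shifting the levels by `lev`. -/
theorem exists_tree_action {Γ G : Type*} [Group Γ] [Finite G] [Nonempty G]
    (lev : Γ →* Multiplicative ℤ) (τ : Γ) (hlτ : lev τ = Multiplicative.ofAdd 1)
    (A : Subgroup Γ) (hA : A ≤ lev.ker) (hτ : ∀ a ∈ A, τ * a * τ⁻¹ ∈ A) (s : G → Γ)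
    (hs : ∀ g, s g ∈ A) (hs_inj : ∀ g g', τ⁻¹ * ((s g)⁻¹ * s g') * τ ∈ A → g = g')
    (hs_surj : ∀ a ∈ A, ∃ g, τ⁻¹ * ((s g)⁻¹ * a) * τ ∈ A)
    (htail : ∀ γ ∈ lev.ker, ∃ k : ℕ, τ ^ k * γ * (τ ^ k)⁻¹ ∈ A) :
    ∃ (ρ : Γ →* Equiv.Perm (HoroVertex (Nat.card G))) (o : HoroVertex (Nat.card G)),
      o.level = 0 ∧ (∀ γ v, (ρ γ v).level = (lev γ).toAdd + v.level) ∧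
      (∀ γ v, (ρ γ v).pred = ρ γ v.pred) ∧ (∀ γ, ρ γ o = o ↔ γ ∈ A) ∧ ∀ v, ∃ γ, ρ γ o = v := by
  let lvl : Γ ⧸ A → ℤ := Quotient.lift (fun γ => (lev γ).toAdd) (by
    intro a b hab
    have h : a⁻¹ * b ∈ lev.ker := hA (QuotientGroup.leftRel_apply.mp hab)
    rw [MonoidHom.mem_ker, map_mul, map_inv, inv_mul_eq_one] at h
    exact congrArg Multiplicative.toAdd h)
  let pr : Γ ⧸ A → Γ ⧸ A := Quotient.map (fun γ => γ * τ⁻¹) (by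
    intro a b hab
    refine QuotientGroup.leftRel_apply.mpr ?_
    have h := hτ _ (QuotientGroup.leftRel_apply.mp hab)
    simpa [mul_assoc] using h)
  have hlvl_mk : ∀ γ : Γ, lvl (γ : Γ ⧸ A) = (lev γ).toAdd := fun _ => rfl
  have hpr_mk : ∀ γ : Γ, pr (γ : Γ ⧸ A) = ((γ * τ⁻¹ : Γ) : Γ ⧸ A) := fun _ => rfl
  have hlev_zpow : ∀ n : ℤ, (lev (τ ^ n)).toAdd = n := by
    intro n
    simp [hlτ]
  have hiter : ∀ (k : ℕ) (γ : Γ), pr^[k] (γ : Γ ⧸ A) = ((γ * (τ ^ k)⁻¹ : Γ) : Γ ⧸ A) := by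
    intro k
    induction k with
    | zero => intro γ; simp
    | succ k ih =>
      intro γ
      rw [Function.iterate_succ_apply, hpr_mk, ih, pow_succ, mul_inv_rev, mul_assoc]
  obtain ⟨e, he_lvl, he_pred⟩ := exists_equiv_horoVertex (X := Γ ⧸ A) (q := Nat.card G)
    Nat.card_pos lvl pr
    (by
      intro x
      induction x using QuotientGroup.induction_on with
      | H γ =>
        rw [hpr_mk, hlvl_mk, hlvl_mk, map_mul, map_inv, hlτ]
        rfl)
    (by
      intro x
      induction x using QuotientGroup.induction_on with
      | H γ =>
        symm
        -- The successors of `γ A` are the cosets `γ s(g) τ A`, because `s` is a transversal of `τ A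
        -- τ⁻¹` in `A`.
        refine Nat.card_eq_of_bijective (fun g : G => ⟨((γ * s g * τ : Γ) : Γ ⧸ A), ?_⟩) ⟨?_, ?_⟩
        · rw [hpr_mk, QuotientGroup.eq]
          have := A.inv_mem (hs g)
          simpa [mul_assoc] using this
        · intro g g' h
          refine hs_inj g g' ?_
          have h' := QuotientGroup.eq.mp (congrArg Subtype.val h)
          simpa [mul_assoc] using h'
        · rintro ⟨y, hy⟩
          induction y using QuotientGroup.induction_on with
          | H δ =>
            rw [hpr_mk] at hy
            obtain ⟨g, hg⟩ := hs_surj _ (QuotientGroup.eq.mp hy.symm)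
            refine ⟨g, Subtype.ext (QuotientGroup.eq.mpr ?_)⟩
            simpa [mul_assoc] using hg)
    (fun n => ((τ ^ n : Γ) : Γ ⧸ A)) (fun n => by rw [hlvl_mk, hlev_zpow])
    (fun n => by rw [hpr_mk, zpow_sub_one])
    (by
      intro x
      induction x using QuotientGroup.induction_on with
      | H γ =>
        -- Dividing by a power of `τ` brings `γ` to level `0`, where the contraction hypothesis
        -- applies.
        obtain ⟨k, hk⟩ := htail (τ ^ (-(lev γ).toAdd) * γ) (by
          rw [MonoidHom.mem_ker, map_mul]
          apply Multiplicative.toAdd.injective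
          rw [toAdd_mul, hlev_zpow]
          simp)
        refine ⟨k, ?_⟩
        rw [hiter, hlvl_mk, eq_comm, QuotientGroup.eq]
        convert hk using 1
        rw [zpow_sub, zpow_neg, zpow_natCast]
        group)
  have hρ : ∀ γ v, (e.permCongrHom.toMonoidHom.comp (MulAction.toPermHom Γ (Γ ⧸ A))) γ v =
      e (γ • e.symm v) := fun γ v => rfl
  refine ⟨e.permCongrHom.toMonoidHom.comp (MulAction.toPermHom Γ (Γ ⧸ A)),
    e ((1 : Γ) : Γ ⧸ A), ?_, ?_, ?_, ?_, ?_⟩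
  · rw [he_lvl, hlvl_mk]
    simp
  · intro γ v
    obtain ⟨x, rfl⟩ := e.surjective v
    rw [hρ, e.symm_apply_apply, he_lvl, he_lvl]
    induction x using QuotientGroup.induction_on with
    | H δ =>
      change (lev (γ * δ)).toAdd = (lev γ).toAdd + (lev δ).toAdd
      rw [map_mul, toAdd_mul]
  · intro γ v
    obtain ⟨x, rfl⟩ := e.surjective v
    rw [hρ, e.symm_apply_apply, he_pred, he_pred, hρ, e.symm_apply_apply]
    induction x using QuotientGroup.induction_on with
    | H δ =>
      congr 1
      change ((γ * δ * τ⁻¹ : Γ) : Γ ⧸ A) = ((γ * (δ * τ⁻¹) : Γ) : Γ ⧸ A)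
      rw [mul_assoc]
  · intro γ
    rw [hρ, e.symm_apply_apply, e.apply_eq_iff_eq]
    change ((γ * 1 : Γ) : Γ ⧸ A) = ((1 : Γ) : Γ ⧸ A) ↔ _
    rw [eq_comm, QuotientGroup.eq]
    simp
  · intro v
    obtain ⟨x, rfl⟩ := e.surjective v
    induction x using QuotientGroup.induction_on with
    | H δ =>
      refine ⟨δ, ?_⟩
      rw [hρ, e.symm_apply_apply]
      change e ((δ * 1 : Γ) : Γ ⧸ A) = _
      rw [mul_one]

/-- A group with two subgroups `A`, `B` of the kernel of `lev` which are complementary in that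
kernel and are contracted by `t` and `t⁻¹` respectively, with the same finite index, acts simply
transitively on a Diestel–Leader graph. -/
theorem isCrossWiredLamplighter_of_complement {Γ G : Type*} [Group Γ] [Finite G] [Nontrivial G]
    (lev : Γ →* Multiplicative ℤ) (t : Γ) (hlt : lev t = Multiplicative.ofAdd 1)
    (A B : Subgroup Γ) (hA : A ≤ lev.ker) (hB : B ≤ lev.ker)
    (htA : ∀ a ∈ A, t * a * t⁻¹ ∈ A) (htB : ∀ b ∈ B, t⁻¹ * b * t ∈ B)
    (s r : G → Γ) (hs : ∀ g, s g ∈ A) (hr : ∀ g, r g ∈ B)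
    (hs_inj : ∀ g g', t⁻¹ * ((s g)⁻¹ * s g') * t ∈ A → g = g')
    (hr_inj : ∀ g g', t * ((r g)⁻¹ * r g') * t⁻¹ ∈ B → g = g')
    (hs_surj : ∀ a ∈ A, ∃ g, t⁻¹ * ((s g)⁻¹ * a) * t ∈ A)
    (hr_surj : ∀ b ∈ B, ∃ g, t * ((r g)⁻¹ * b) * t⁻¹ ∈ B)
    (hA_tail : ∀ γ ∈ lev.ker, ∃ k : ℕ, t ^ k * γ * (t ^ k)⁻¹ ∈ A)
    (hB_tail : ∀ γ ∈ lev.ker, ∃ k : ℕ, (t ^ k)⁻¹ * γ * t ^ k ∈ B)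
    (hAB : ∀ γ ∈ A, γ ∈ B → γ = 1) (hmul : ∀ γ ∈ lev.ker, ∃ a ∈ A, ∃ b ∈ B, γ = a * b) :
    IsCrossWiredLamplighter Γ := by
  obtain ⟨ρ, o, ho, hρl, hρp, hρs, hρt⟩ :=
    exists_tree_action lev t hlt A hA htA s hs hs_inj hs_surj hA_tail
  have hker : lev⁻¹.ker = lev.ker := by
    ext γ
    simp [MonoidHom.mem_ker]
  obtain ⟨σ, p, hp, hσl, hσp, hσs, hσt⟩ :=
    exists_tree_action lev⁻¹ t⁻¹ (by simp [hlt]) B (hker ▸ hB) (by simpa using htB) r hr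
      (by simpa using hr_inj) (by simpa using hr_surj) (by rw [hker]; simpa using hB_tail)
  have hadj : ∀ {q : ℕ} (π : Equiv.Perm (HoroVertex q)), (∀ v, (π v).pred = π v.pred) →
      ∀ v w, (regularTree q).Adj (π v) (π w) ↔ (regularTree q).Adj v w := by
    intro q π h v w
    change (π v).pred = π w ∨ (π w).pred = π v ↔ v.pred = w ∨ w.pred = v
    rw [h, h, π.apply_eq_iff_eq, π.apply_eq_iff_eq]
  have hsum : ∀ γ (x : DLVertex (Nat.card G) (Nat.card G)),
      (ρ γ x.1.1).level + (σ γ x.1.2).level = 0 := by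
    intro γ x
    rw [hρl, hσl]
    have := x.2
    simp only [MonoidHom.inv_apply, toAdd_inv]
    omega
  let f : Γ → DLVertex (Nat.card G) (Nat.card G) → DLVertex (Nat.card G) (Nat.card G) :=
    fun γ x => ⟨(ρ γ x.1.1, σ γ x.1.2), hsum γ x⟩
  have hf_one : ∀ x, f 1 x = x := fun x => Subtype.ext (by simp [f])
  have hf_mul : ∀ γ δ x, f (γ * δ) x = f γ (f δ x) := fun γ δ x => Subtype.ext (by simp [f])
  let φ : Γ →* (diestelLeader (Nat.card G) (Nat.card G) ≃g diestelLeader (Nat.card G) (Nat.card G)) :=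
    { toFun := fun γ =>
        { toFun := f γ
          invFun := f γ⁻¹
          left_inv := fun x => by rw [← hf_mul, inv_mul_cancel, hf_one]
          right_inv := fun x => by rw [← hf_mul, mul_inv_cancel, hf_one]
          map_rel_iff' := fun {x y} =>
            and_congr (hadj (ρ γ) (hρp γ) x.1.1 y.1.1) (hadj (σ γ) (hσp γ) x.1.2 y.1.2) }
      map_one' := RelIso.ext hf_one
      map_mul' := fun γ δ => RelIso.ext (hf_mul γ δ) }
  have hφ : ∀ γ x, φ γ x = f γ x := fun _ _ => rfl
  let O : DLVertex (Nat.card G) (Nat.card G) := ⟨(o, p), by rw [ho, hp, add_zero]⟩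
  have hstab : ∀ γ, φ γ O = O → γ = 1 := by
    intro γ h
    have h' := congrArg Subtype.val h
    exact hAB γ ((hρs γ).mp (congrArg Prod.fst h')) ((hσs γ).mp (congrArg Prod.snd h'))
  have htrans : ∀ x, ∃ γ, φ γ O = x := by
    rintro ⟨⟨u, v⟩, huv⟩
    obtain ⟨γ, rfl⟩ := hρt u
    obtain ⟨δ, rfl⟩ := hσt v
    have hl : lev γ = lev δ := by
      apply Multiplicative.toAdd.injective
      simp only [hρl, hσl, ho, hp, MonoidHom.inv_apply, toAdd_inv] at huv
      omega
    -- From `γ⁻¹ δ = a b` follows `γ a = δ b⁻¹`. This element agrees with `γ` on the first base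
    -- point and with `δ` on the second.
    obtain ⟨a, ha, b, hb, hab⟩ := hmul (γ⁻¹ * δ) (by
      rw [MonoidHom.mem_ker, map_mul, map_inv, hl, inv_mul_cancel])
    refine ⟨γ * a, Subtype.ext (Prod.ext ?_ ?_)⟩
    · change ρ (γ * a) o = ρ γ o
      rw [map_mul, Equiv.Perm.mul_apply, (hρs a).mpr ha]
    · have hδ : γ * a = δ * b⁻¹ := by
        rw [eq_mul_inv_iff_mul_eq, mul_assoc, ← hab, mul_inv_cancel_left]
      change σ (γ * a) p = σ δ p
      rw [hδ, map_mul, Equiv.Perm.mul_apply, (hσs b⁻¹).mpr (B.inv_mem hb)]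
  have hfree : ∀ γ δ x, φ γ x = φ δ x → γ = δ := by
    intro γ δ x h
    obtain ⟨ε, rfl⟩ := htrans x
    have h1 : φ (ε⁻¹ * (δ⁻¹ * (γ * ε))) O = O := by
      have h2 : φ γ (φ ε O) = φ δ (φ ε O) := h
      simp only [map_mul, RelIso.mul_apply, h2]
      simp only [← RelIso.mul_apply, ← map_mul]
      simp
    have h3 := hstab _ h1
    rw [inv_mul_eq_one, eq_comm, inv_mul_eq_iff_eq_mul] at h3
    exact mul_right_cancel h3
  refine ⟨Nat.card G, Finite.one_lt_card, φ, ?_, ?_, ?_⟩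
  · intro γ δ h
    exact hfree γ δ O (by rw [h])
  · intro K hK
    refine (hK.biUnion fun v _ => hK.biUnion fun w _ =>
      (Set.Subsingleton.finite (s := {γ | φ γ v = w}) fun γ hγ δ hδ => ?_)).subset ?_
    · exact hfree γ δ v (Eq.trans hγ (Eq.symm hδ))
    · rintro γ ⟨_, ⟨v, hv, rfl⟩, hw⟩
      exact Set.mem_biUnion hv (Set.mem_biUnion hw rfl)
  · exact ⟨{O}, Set.finite_singleton O, fun v => (htrans v).imp fun γ h => ⟨O, rfl, h⟩⟩

/-! ### The partial-product map and central translations. -/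

/-- The permutations of the set of words which only change the letters up to the index `d`. -/
def tailFixing (A : Type*) (d : ℕ) : Subgroup (Equiv.Perm (ℕ → A)) where
  carrier := {f | ∀ w n, d < n → f w n = w n}
  mul_mem' := fun {f g} hf hg w n hn => by
    rw [Equiv.Perm.mul_apply, hf _ n hn, hg _ n hn]
  one_mem' := fun _ _ _ => rfl
  inv_mem' := fun {f} hf w n hn => by
    have h := hf (f⁻¹ w) n hn
    rw [Equiv.Perm.coe_inv, Equiv.apply_symm_apply] at h
    exact h.symm

theorem tailFixing_mono {A : Type*} {d e : ℕ} (h : d ≤ e) : tailFixing A d ≤ tailFixing A e :=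
  fun _ hf w n hn => hf w n (lt_of_le_of_lt h hn)

section CayleyMachine

variable {G : Type*} [Group G]

/-- The transformation of the Cayley machine in the state `1`: the sequence of partial products. -/
def partialProd (G : Type*) [Group G] : Equiv.Perm (ℕ → G) := (cayleyMachine G).statePerm 1

theorem partialProd_apply_zero (w : ℕ → G) : partialProd G w 0 = w 0 := by
  change 1 * w 0 = w 0
  rw [one_mul]

theorem partialProd_apply_succ (w : ℕ → G) (n : ℕ) :
    partialProd G w (n + 1) = partialProd G w n * w (n + 1) := rfl

theorem partialProd_inv_apply_zero (w : ℕ → G) : (partialProd G)⁻¹ w 0 = w 0 := by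
  obtain ⟨u, rfl⟩ := (partialProd G).surjective w
  rw [Equiv.Perm.coe_inv, Equiv.symm_apply_apply, partialProd_apply_zero]

theorem partialProd_inv_apply_succ (w : ℕ → G) (n : ℕ) :
    (partialProd G)⁻¹ w (n + 1) = (w n)⁻¹ * w (n + 1) := by
  obtain ⟨u, rfl⟩ := (partialProd G).surjective w
  rw [Equiv.Perm.coe_inv, Equiv.symm_apply_apply, partialProd_apply_succ, inv_mul_cancel_left]

theorem partialProd_apply_one : partialProd G 1 = 1 := by
  funext n
  induction n with
  | zero => exact partialProd_apply_zero 1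
  | succ n ih => rw [partialProd_apply_succ, ih]; simp

/-- Left multiplication of the first letter of a word. -/
def firstMul (G : Type*) [Group G] : G →* Equiv.Perm (ℕ → G) :=
  (MulAction.toPermHom (ℕ → G) (ℕ → G)).comp (MonoidHom.mulSingle (fun _ : ℕ => G) 0)

theorem firstMul_apply (g : G) (w : ℕ → G) : firstMul G g w = Pi.mulSingle 0 g * w := rfl

/-- Multiplying the first letter by `g` has the same effect on all later states as starting in `g`.
This reduces the generators to `partialProd G` and the first-letter multiplications. -/
theorem statePerm_cayleyMachine (g : G) :
    (cayleyMachine G).statePerm g = partialProd G * firstMul G g := by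
  ext w n
  rw [Equiv.Perm.mul_apply, firstMul_apply]
  induction n with
  | zero =>
    rw [partialProd_apply_zero]
    simp [InvertibleAutomaton.statePerm, InvertibleAutomaton.transform,
      InvertibleAutomaton.stateAt, cayleyMachine]
  | succ n ih =>
    rw [partialProd_apply_succ, ← ih]
    simp [mul_assoc, InvertibleAutomaton.statePerm, InvertibleAutomaton.transform,
      InvertibleAutomaton.stateAt, cayleyMachine]

/-- The words with central letters. -/
def centralWords (G : Type*) [Group G] : Subgroup (ℕ → G) :=
  Subgroup.pi Set.univ fun _ => Subgroup.center G

theorem mem_centralWords {z : ℕ → G} : z ∈ centralWords G ↔ ∀ n, z n ∈ Subgroup.center G := by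
  simp [centralWords, Subgroup.mem_pi]

theorem centralWords_comm {z : ℕ → G} (hz : z ∈ centralWords G) (w : ℕ → G) : w * z = z * w :=
  funext fun n => Subgroup.mem_center_iff.mp (mem_centralWords.mp hz n) (w n)

theorem partialProd_mem_centralWords {z : ℕ → G} (hz : z ∈ centralWords G) :
    partialProd G z ∈ centralWords G := by
  rw [mem_centralWords] at hz ⊢
  intro n
  induction n with
  | zero => rw [partialProd_apply_zero]; exact hz 0
  | succ n ih => rw [partialProd_apply_succ]; exact mul_mem ih (hz _)

theorem partialProd_inv_mem_centralWords {z : ℕ → G} (hz : z ∈ centralWords G) :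
    (partialProd G)⁻¹ z ∈ centralWords G := by
  rw [mem_centralWords] at hz ⊢
  intro n
  cases n with
  | zero => rw [partialProd_inv_apply_zero]; exact hz 0
  | succ n => rw [partialProd_inv_apply_succ]; exact mul_mem (inv_mem (hz _)) (hz _)

/-- Central letters can be moved out of the partial products. Consequently `partialProd G`
normalizes the central translations. -/
theorem partialProd_central_mul {z : ℕ → G} (hz : z ∈ centralWords G) (w : ℕ → G) :
    partialProd G (z * w) = partialProd G z * partialProd G w := by
  funext n
  induction n with
  | zero => simp only [Pi.mul_apply, partialProd_apply_zero]
  | succ n ih =>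
    have h := Subgroup.mem_center_iff.mp (mem_centralWords.mp hz (n + 1)) (partialProd G w n)
    simp only [Pi.mul_apply, partialProd_apply_succ] at ih ⊢
    rw [ih, mul_assoc, ← mul_assoc _ (z (n + 1)), h]
    simp only [mul_assoc]

/-- The multiplications with words with central letters. -/
def centralTranslations (G : Type*) [Group G] : Subgroup (Equiv.Perm (ℕ → G)) :=
  (centralWords G).map (MulAction.toPermHom (ℕ → G) (ℕ → G))

theorem mem_centralTranslations {f : Equiv.Perm (ℕ → G)} :
    f ∈ centralTranslations G ↔ ∃ z ∈ centralWords G, ∀ w, f w = z * w := by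
  constructor
  · rintro ⟨z, hz, rfl⟩
    exact ⟨z, hz, fun w => rfl⟩
  · rintro ⟨z, hz, h⟩
    exact ⟨z, hz, Equiv.ext fun w => (h w).symm⟩

theorem partialProd_conj_mem_centralTranslations {f : Equiv.Perm (ℕ → G)}
    (hf : f ∈ centralTranslations G) :
    partialProd G * f * (partialProd G)⁻¹ ∈ centralTranslations G := by
  obtain ⟨z, hz, h⟩ := mem_centralTranslations.mp hf
  refine mem_centralTranslations.mpr ⟨_, partialProd_mem_centralWords hz, fun w => ?_⟩
  rw [Equiv.Perm.mul_apply, Equiv.Perm.mul_apply, h, partialProd_central_mul hz,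
    Equiv.Perm.coe_inv, Equiv.apply_symm_apply]

theorem partialProd_inv_conj_mem_centralTranslations {f : Equiv.Perm (ℕ → G)}
    (hf : f ∈ centralTranslations G) :
    (partialProd G)⁻¹ * f * partialProd G ∈ centralTranslations G := by
  obtain ⟨z, hz, h⟩ := mem_centralTranslations.mp hf
  refine mem_centralTranslations.mpr ⟨_, partialProd_inv_mem_centralWords hz, fun w => ?_⟩
  rw [Equiv.Perm.mul_apply, Equiv.Perm.mul_apply, h, Equiv.Perm.inv_eq_iff_eq,
    partialProd_central_mul (partialProd_inv_mem_centralWords hz), Equiv.Perm.coe_inv, Equiv.apply_symm_apply]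

theorem partialProd_zpow_conj_mem_centralTranslations (n : ℤ) {f : Equiv.Perm (ℕ → G)}
    (hf : f ∈ centralTranslations G) :
    partialProd G ^ n * f * (partialProd G ^ n)⁻¹ ∈ centralTranslations G := by
  have h : partialProd G ∈ Subgroup.normalizer (centralTranslations G : Set _) := by
    rw [Subgroup.mem_normalizer_iff]
    refine fun f => ⟨partialProd_conj_mem_centralTranslations, fun hf => ?_⟩
    have := partialProd_inv_conj_mem_centralTranslations hf
    simpa [mul_assoc] using this
  exact (Subgroup.mem_normalizer_iff.mp (zpow_mem h n) f).mp hf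

theorem commute_firstMul_of_mem_centralTranslations {f : Equiv.Perm (ℕ → G)}
    (hf : f ∈ centralTranslations G) (g : G) : Commute f (firstMul G g) := by
  obtain ⟨z, hz, h⟩ := mem_centralTranslations.mp hf
  refine Equiv.ext fun w => ?_
  rw [Equiv.Perm.mul_apply, Equiv.Perm.mul_apply, h, firstMul_apply, firstMul_apply, h,
    ← mul_assoc, ← mul_assoc, centralWords_comm hz]

theorem partialProd_inv_conj_mem_tailFixing {d : ℕ} {f : Equiv.Perm (ℕ → G)}
    (hf : f ∈ tailFixing G d) : (partialProd G)⁻¹ * f * partialProd G ∈ tailFixing G (d + 1) := by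
  intro w n hn
  obtain ⟨m, rfl⟩ : ∃ m, n = m + 1 := ⟨n - 1, by omega⟩
  rw [Equiv.Perm.mul_apply, Equiv.Perm.mul_apply, partialProd_inv_apply_succ,
    hf _ _ (by omega), hf _ _ (by omega), partialProd_apply_succ, inv_mul_cancel_left]

/-- Each application of the inverse moves the end of the support one place to the right and inverts
the letter there, since `(w m)⁻¹ * 1` appears at `m + 1`. -/
theorem partialProd_inv_pow_support (k m : ℕ) (w : ℕ → G) (hw : ∀ n, m < n → w n = 1) :
    (∀ n, m + k < n → ((partialProd G)⁻¹ ^ k) w n = 1) ∧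
      ((partialProd G)⁻¹ ^ k) w (m + k) = w m ^ ((-1 : ℤ) ^ k) := by
  induction k with
  | zero => simpa using hw
  | succ k ih =>
    rw [pow_succ', Equiv.Perm.mul_def]
    constructor
    · intro n hn
      obtain ⟨j, rfl⟩ : ∃ j, n = j + 1 := ⟨n - 1, by omega⟩
      rw [Equiv.trans_apply, partialProd_inv_apply_succ, ih.1 _ (by omega), ih.1 _ (by omega)]
      simp
    · rw [← add_assoc, Equiv.trans_apply, partialProd_inv_apply_succ, ih.2, ih.1 _ (by omega)]
      rw [mul_one, ← zpow_neg, pow_succ]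
      simp

/-! ### Lamps and the subgroups they generate. -/

/-- The conjugates of the multiplications of the first letter by the powers of `partialProd`. -/
def lamp (k : ℤ) (g : G) : Equiv.Perm (ℕ → G) :=
  partialProd G ^ k * firstMul G g * (partialProd G ^ k)⁻¹

theorem lamp_zero (g : G) : lamp 0 g = firstMul G g := by simp [lamp]

theorem lamp_one (k : ℤ) : lamp k (1 : G) = 1 := by simp [lamp]

theorem lamp_mul (k : ℤ) (g h : G) : lamp k (g * h) = lamp k g * lamp k h := by
  simp [lamp, mul_assoc]

theorem lamp_inv (k : ℤ) (g : G) : lamp k g⁻¹ = (lamp k g)⁻¹ := by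
  simp [lamp, mul_assoc]

theorem conj_lamp (n k : ℤ) (g : G) :
    partialProd G ^ n * lamp k g * (partialProd G ^ n)⁻¹ = lamp (n + k) g := by
  simp [lamp, zpow_add, mul_assoc]

theorem lamp_neg_succ (d : ℕ) (g : G) :
    lamp (-((d + 1 : ℕ) : ℤ)) g = (partialProd G)⁻¹ * lamp (-(d : ℤ)) g * partialProd G := by
  have h := conj_lamp (-1) (-(d : ℤ)) g
  rw [zpow_neg_one, inv_inv] at h
  rw [h]
  congr 1
  push_cast
  ring

theorem lamp_injective (k : ℤ) : Function.Injective (lamp k : G → Equiv.Perm (ℕ → G)) := by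
  intro g h hgh
  have h1 : firstMul G g = firstMul G h := by simpa [lamp] using hgh
  have h2 := congrFun (congrArg (fun f : Equiv.Perm (ℕ → G) => f 1) h1) 0
  simpa [firstMul_apply] using h2

theorem firstMul_mem_tailFixing (g : G) : firstMul G g ∈ tailFixing G 0 := by
  intro w n hn
  rw [firstMul_apply, Pi.mul_apply, Pi.mulSingle_eq_of_ne hn.ne', one_mul]

theorem lamp_neg_mem_tailFixing (d : ℕ) (g : G) : lamp (-(d : ℤ)) g ∈ tailFixing G d := by
  induction d with
  | zero => simpa [lamp_zero] using firstMul_mem_tailFixing g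
  | succ d ih => rw [lamp_neg_succ]; exact partialProd_inv_conj_mem_tailFixing ih

theorem lamp_neg_apply_one (d : ℕ) (g : G) :
    lamp (-(d : ℤ)) g 1 = ((partialProd G)⁻¹ ^ d) (Pi.mulSingle 0 g) := by
  have h : (partialProd G ^ d) 1 = 1 := by
    induction d with
    | zero => rfl
    | succ d ih => rw [pow_succ', Equiv.Perm.mul_apply, ih, partialProd_apply_one]
  rw [lamp, zpow_neg, inv_inv, zpow_natCast, Equiv.Perm.mul_apply, Equiv.Perm.mul_apply, h,
    firstMul_apply, mul_one, inv_pow]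

theorem lamp_neg_apply_one_support (d : ℕ) (g : G) :
    (∀ n, d < n → lamp (-(d : ℤ)) g 1 n = 1) ∧ lamp (-(d : ℤ)) g 1 d = g ^ ((-1 : ℤ) ^ d) := by
  have h := partialProd_inv_pow_support d 0 (Pi.mulSingle 0 g)
    (fun n hn => by rw [Pi.mulSingle_eq_of_ne hn.ne'])
  rw [lamp_neg_apply_one]
  simpa using h

theorem lamp_mem_centralTranslations (k : ℤ) {g : G} (hg : g ∈ Subgroup.center G) :
    lamp k g ∈ centralTranslations G := by
  refine partialProd_zpow_conj_mem_centralTranslations k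
    (mem_centralTranslations.mpr ⟨Pi.mulSingle 0 g, mem_centralWords.mpr fun n => ?_, fun w => rfl⟩)
  rcases eq_or_ne n 0 with rfl | hn
  · simpa using hg
  · rw [Pi.mulSingle_eq_of_ne hn]
    exact one_mem _

/-- Conjugating by `partialProd G ^ (-k)` turns the second lamp into a first-letter multiplication,
while the first stays a central translation. -/
theorem commute_lamp_of_mem_center (i k : ℤ) {z : G} (hz : z ∈ Subgroup.center G) (g : G) :
    Commute (lamp i z) (lamp k g) := by
  have h := commute_firstMul_of_mem_centralTranslations (lamp_mem_centralTranslations (-k + i) hz) g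
  have h' := congrArg (fun x => partialProd G ^ k * x * (partialProd G ^ k)⁻¹) h.eq
  rw [← lamp_zero] at h'
  change lamp i z * lamp k g = lamp k g * lamp i z
  have e1 := conj_lamp k (-k + i) z
  have e2 := conj_lamp k 0 g
  rw [add_neg_cancel_left] at e1
  rw [add_zero] at e2
  rw [← e1, ← e2]
  simpa [mul_assoc] using h'

/-- The subgroup generated by the lamps with index in `S` and colour in `Z`. -/
def lampSubgroup (Z : Subgroup G) (S : Set ℤ) : Subgroup (Equiv.Perm (ℕ → G)) :=
  Subgroup.closure {x | ∃ k ∈ S, ∃ g ∈ Z, lamp k g = x}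

theorem lamp_mem_lampSubgroup {Z : Subgroup G} {S : Set ℤ} {k : ℤ} {g : G} (hk : k ∈ S)
    (hg : g ∈ Z) : lamp k g ∈ lampSubgroup Z S :=
  Subgroup.subset_closure ⟨k, hk, g, hg, rfl⟩

theorem lampSubgroup_le {Z : Subgroup G} {S : Set ℤ} {K : Subgroup (Equiv.Perm (ℕ → G))} :
    lampSubgroup Z S ≤ K ↔ ∀ k ∈ S, ∀ g ∈ Z, lamp k g ∈ K := by
  rw [lampSubgroup, Subgroup.closure_le]
  constructor
  · exact fun h k hk g hg => h ⟨k, hk, g, hg, rfl⟩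
  · rintro h _ ⟨k, hk, g, hg, rfl⟩
    exact h k hk g hg

theorem lampSubgroup_mono {Y Z : Subgroup G} {S T : Set ℤ} (hYZ : Y ≤ Z) (hST : S ⊆ T) :
    lampSubgroup Y S ≤ lampSubgroup Z T :=
  lampSubgroup_le.mpr fun _ hk _ hg => lamp_mem_lampSubgroup (hST hk) (hYZ hg)

theorem conj_mem_lampSubgroup {Z : Subgroup G} {S T : Set ℤ} (n : ℤ) (hST : ∀ k ∈ S, n + k ∈ T)
    {x : Equiv.Perm (ℕ → G)} (hx : x ∈ lampSubgroup Z S) :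
    partialProd G ^ n * x * (partialProd G ^ n)⁻¹ ∈ lampSubgroup Z T := by
  have h : lampSubgroup Z S ≤
      (lampSubgroup Z T).comap (MulAut.conj (partialProd G ^ n)).toMonoidHom := by
    refine lampSubgroup_le.mpr fun k hk g hg => ?_
    change partialProd G ^ n * lamp k g * (partialProd G ^ n)⁻¹ ∈ lampSubgroup Z T
    rw [conj_lamp]
    exact lamp_mem_lampSubgroup (hST k hk) hg
  exact h hx

theorem exists_mem_lampSubgroup_inter_Icc {Z : Subgroup G} {S : Set ℤ}
    {x : Equiv.Perm (ℕ → G)} (hx : x ∈ lampSubgroup Z S) :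
    ∃ m : ℕ, x ∈ lampSubgroup Z (S ∩ Set.Icc (-(m : ℤ)) m) := by
  have hmono : ∀ {m n : ℕ}, m ≤ n → lampSubgroup Z (S ∩ Set.Icc (-(m : ℤ)) m) ≤
      lampSubgroup Z (S ∩ Set.Icc (-(n : ℤ)) n) := fun h =>
    lampSubgroup_mono le_rfl (Set.inter_subset_inter_right _
      (Set.Icc_subset_Icc (by omega) (by omega)))
  induction hx using Subgroup.closure_induction with
  | mem x hx =>
    obtain ⟨k, hk, g, hg, rfl⟩ := hx
    exact ⟨k.natAbs, lamp_mem_lampSubgroup ⟨hk, by constructor <;> omega⟩ hg⟩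
  | one => exact ⟨0, one_mem _⟩
  | mul x y _ _ hx hy =>
    obtain ⟨m, hm⟩ := hx
    obtain ⟨n, hn⟩ := hy
    exact ⟨max m n, mul_mem (hmono (le_max_left _ _) hm) (hmono (le_max_right _ _) hn)⟩
  | inv x _ hx =>
    obtain ⟨m, hm⟩ := hx
    exact ⟨m, inv_mem hm⟩

theorem commute_of_mem_lampSubgroup_center {S T : Set ℤ} {Z : Subgroup G}
    {c x : Equiv.Perm (ℕ → G)}
    (hc : c ∈ lampSubgroup (Subgroup.center G) S) (hx : x ∈ lampSubgroup Z T) : Commute c x := by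
  have h1 : ∀ k (g : G), lampSubgroup (Subgroup.center G) S ≤ Subgroup.centralizer {lamp k g} :=
    fun k g => lampSubgroup_le.mpr fun i _ z hz => Subgroup.mem_centralizer_singleton_iff.mpr
      (commute_lamp_of_mem_center i k hz g).eq
  have h2 : lampSubgroup Z T ≤ Subgroup.centralizer {c} :=
    lampSubgroup_le.mpr fun k _ g _ => Subgroup.mem_centralizer_singleton_iff.mpr
      (Subgroup.mem_centralizer_singleton_iff.mp (h1 k g hc)).symm
  exact (Subgroup.mem_centralizer_singleton_iff.mp (h2 hx)).symm

/-- A translation by a word with central letters, trivial from some index on, is a product of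
central lamps. -/
theorem mem_lampSubgroup_of_tailFixing {d : ℕ} {f : Equiv.Perm (ℕ → G)}
    (hf : f ∈ centralTranslations G) (hd : f ∈ tailFixing G d) :
    f ∈ lampSubgroup (Subgroup.center G) (Set.Icc (-(d : ℤ)) 0) := by
  induction d generalizing f with
  | zero =>
    obtain ⟨z, hz, h⟩ := mem_centralTranslations.mp hf
    have hfz : f = lamp 0 (z 0) := by
      rw [lamp_zero]
      ext w n
      rw [h, firstMul_apply]
      rcases eq_or_ne n 0 with rfl | hn
      · simp
      · have h1 := hd w n (by omega)
        rw [h] at h1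
        rw [h1, Pi.mul_apply, Pi.mulSingle_eq_of_ne hn, one_mul]
    rw [hfz]
    exact lamp_mem_lampSubgroup (by simp) (mem_centralWords.mp hz 0)
  | succ d ih =>
    obtain ⟨z, hz, h⟩ := mem_centralTranslations.mp hf
    have hy : z (d + 1) ^ ((-1 : ℤ) ^ (d + 1)) ∈ Subgroup.center G :=
      zpow_mem (mem_centralWords.mp hz _) _
    -- The sign cancels the one in `lamp_neg_apply_one_support`, so the lamp with colour `y`
    -- translates letter `d + 1` by exactly `z (d + 1)`. Dividing it out lowers `d`.
    set y := z (d + 1) ^ ((-1 : ℤ) ^ (d + 1)) with hydef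
    have hyz : y ^ ((-1 : ℤ) ^ (d + 1)) = z (d + 1) := by
      rw [hydef, ← zpow_mul, ← mul_pow]
      simp
    have hl := lamp_mem_centralTranslations (-((d + 1 : ℕ) : ℤ)) hy
    have hlt := lamp_neg_mem_tailFixing (d + 1) y
    have hq : (lamp (-((d + 1 : ℕ) : ℤ)) y)⁻¹ * f ∈ tailFixing G d := by
      obtain ⟨v, hv, hlv⟩ := mem_centralTranslations.mp (mul_mem (inv_mem hl) hf)
      have hv1 : (lamp (-((d + 1 : ℕ) : ℤ)) y) v = z := by
        have h1 := hlv 1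
        rw [mul_one, Equiv.Perm.mul_apply, Equiv.Perm.inv_eq_iff_eq, h, mul_one] at h1
        exact h1.symm
      obtain ⟨u, hu, hlu⟩ := mem_centralTranslations.mp hl
      intro w n hn
      rcases (Nat.succ_le_of_lt hn).eq_or_lt with rfl | hn'
      · rw [hlv, Pi.mul_apply]
        have hud : u (d + 1) = z (d + 1) := by
          have h2 := (lamp_neg_apply_one_support (d + 1) y).2
          rwa [hlu, mul_one, hyz] at h2
        have h3 := congrFun hv1 (d + 1)
        rw [hlu, Pi.mul_apply, hud, mul_eq_left] at h3
        rw [Nat.succ_eq_add_one, h3, one_mul]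
      · exact mul_mem (inv_mem hlt) hd w n hn'
    have hmem := lampSubgroup_mono (T := Set.Icc (-((d + 1 : ℕ) : ℤ)) 0) le_rfl
      (Set.Icc_subset_Icc (by push_cast; omega) le_rfl) (ih (mul_mem (inv_mem hl) hf) hq)
    have := mul_mem (lamp_mem_lampSubgroup (S := Set.Icc (-((d + 1 : ℕ) : ℤ)) 0)
      (k := -((d + 1 : ℕ) : ℤ)) (by constructor <;> push_cast <;> omega) hy) hmem
    rwa [mul_inv_cancel_left] at this

end CayleyMachine

/-! ### Class two: commutators of lamps are products of central lamps. -/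

section ClassTwo

open scoped commutatorElement

variable {G : Type*} [Group G]

/-- The permutations `w ↦ a * w * B w` of the set of words, where `B` is a homomorphism to the
central words which vanishes on the central words. -/
def IsCentrallyTwisted (f : Equiv.Perm (ℕ → G)) : Prop :=
  ∃ (a : ℕ → G) (B : (ℕ → G) → ℕ → G), (∀ w, B w ∈ centralWords G) ∧
    (∀ v w, B (v * w) = B v * B w) ∧ (∀ w ∈ centralWords G, B w = 1) ∧ ∀ w, f w = a * w * B w

theorem isCentrallyTwisted_firstMul (g : G) : IsCentrallyTwisted (firstMul G g) :=
  ⟨Pi.mulSingle 0 g, 1, fun _ => one_mem _, fun _ _ => by simp, fun _ _ => rfl,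
    fun w => by rw [firstMul_apply]; simp⟩

theorem commutator_mem_center (hG : ∀ a b : G, a * b * a⁻¹ * b⁻¹ ∈ Subgroup.center G) (a b : G) :
    a⁻¹ * b⁻¹ * a * b ∈ Subgroup.center G := by
  simpa using hG a⁻¹ b⁻¹

theorem commutator_mul_right (hG : ∀ a b : G, a * b * a⁻¹ * b⁻¹ ∈ Subgroup.center G) (c x y : G) :
    c⁻¹ * (x * y)⁻¹ * c * (x * y) = (c⁻¹ * x⁻¹ * c * x) * (c⁻¹ * y⁻¹ * c * y) := by
  have h := Subgroup.mem_center_iff.mp (commutator_mem_center hG c x) (c⁻¹ * y⁻¹ * c)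
  calc c⁻¹ * (x * y)⁻¹ * c * (x * y)
      = (c⁻¹ * y⁻¹ * c) * (c⁻¹ * x⁻¹ * c * x) * y := by group
    _ = _ := by rw [h]; group

theorem commutator_of_mem_center (c : G) {z : G} (hz : z ∈ Subgroup.center G) :
    c⁻¹ * z⁻¹ * c * z = 1 := by
  have h := Subgroup.mem_center_iff.mp (inv_mem hz) c⁻¹
  rw [h]
  group

/-- The quotient by the center is abelian, so taking partial products is a homomorphism modulo
central words. -/
theorem exists_partialProd_mul (hG : ∀ a b : G, a * b * a⁻¹ * b⁻¹ ∈ Subgroup.center G)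
    (v w : ℕ → G) : ∃ z ∈ centralWords G,
      partialProd G (v * w) = partialProd G v * partialProd G w * z := by
  refine ⟨(partialProd G v * partialProd G w)⁻¹ * partialProd G (v * w),
    mem_centralWords.mpr fun n => ?_, by rw [mul_inv_cancel_left]⟩
  simp only [Pi.mul_apply, Pi.inv_apply]
  induction n with
  | zero =>
    simp only [partialProd_apply_zero, Pi.mul_apply, inv_mul_cancel]
    exact one_mem _
  | succ n ih =>
    simp only [partialProd_apply_succ, Pi.mul_apply]
    set x := partialProd G v n
    set y := partialProd G w n
    set z := partialProd G (v * w) n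
    have hz := Subgroup.mem_center_iff.mp ih
    have key : (x * v (n + 1) * (y * w (n + 1)))⁻¹ * (z * (v (n + 1) * w (n + 1))) =
        ((x * y)⁻¹ * z) * ((w (n + 1))⁻¹ * (y⁻¹ * (v (n + 1))⁻¹ * y * v (n + 1)) * w (n + 1)) := by
      have h1 := hz ((w (n + 1))⁻¹ * (y⁻¹ * (v (n + 1))⁻¹ * y))
      calc _ = ((w (n + 1))⁻¹ * (y⁻¹ * (v (n + 1))⁻¹ * y)) * ((x * y)⁻¹ * z) *
            (v (n + 1) * w (n + 1)) := by group
        _ = _ := by rw [h1]; group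
    rw [key]
    refine mul_mem ih ?_
    have h2 := commutator_mem_center hG y (v (n + 1))
    have h3 := Subgroup.mem_center_iff.mp h2 (w (n + 1))⁻¹
    rw [h3, mul_assoc, inv_mul_cancel, mul_one]
    exact h2

/-- With `c = (a n)⁻¹ * a (n + 1)` and `x = partialProd G w n`, letter `n + 1` of the conjugate is
`x⁻¹ * c * x * w (n + 1)` up to central factors from `B`. The new twist thus combines the commutator
of `c` and `x` with the conjugate of `B`. Both are multiplicative because the central error in
`exists_partialProd_mul` is killed by commutators and by `B`. -/
theorem IsCentrallyTwisted.conj (hG : ∀ a b : G, a * b * a⁻¹ * b⁻¹ ∈ Subgroup.center G)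
    {f : Equiv.Perm (ℕ → G)} (hf : IsCentrallyTwisted f) :
    IsCentrallyTwisted ((partialProd G)⁻¹ * f * partialProd G) := by
  obtain ⟨a, B, hBc, hBm, hB1, hfB⟩ := hf
  have hBt : ∀ v w, B (partialProd G (v * w)) = B (partialProd G v) * B (partialProd G w) := by
    intro v w
    obtain ⟨z, hz, h⟩ := exists_partialProd_mul hG v w
    rw [h, hBm, hBm, hB1 z hz, mul_one]
  have hBt1 : ∀ w ∈ centralWords G, B (partialProd G w) = 1 :=
    fun w hw => hB1 _ (partialProd_mem_centralWords hw)
  let E : (ℕ → G) → ℕ → G := fun w n => n.casesOn 1 fun n =>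
    ((a n)⁻¹ * a (n + 1))⁻¹ * (partialProd G w n)⁻¹ * ((a n)⁻¹ * a (n + 1)) * partialProd G w n
  have hE0 : ∀ w, E w 0 = 1 := fun _ => rfl
  have hE : ∀ w n, E w (n + 1) = ((a n)⁻¹ * a (n + 1))⁻¹ * (partialProd G w n)⁻¹ *
    ((a n)⁻¹ * a (n + 1)) * partialProd G w n := fun _ _ => rfl
  have hEc : ∀ w, E w ∈ centralWords G := by
    refine fun w => mem_centralWords.mpr fun n => ?_
    cases n with
    | zero => exact one_mem _
    | succ n => exact commutator_mem_center hG _ _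
  have hEm : ∀ v w, E (v * w) = E v * E w := by
    intro v w
    funext n
    cases n with
    | zero => simp [hE0]
    | succ n =>
      obtain ⟨z, hz, h⟩ := exists_partialProd_mul hG v w
      rw [Pi.mul_apply, hE, hE, hE, h, Pi.mul_apply, Pi.mul_apply, commutator_mul_right hG,
        commutator_mul_right hG, commutator_of_mem_center _ (mem_centralWords.mp hz n), mul_one]
  have hE1 : ∀ w ∈ centralWords G, E w = 1 := by
    intro w hw
    funext n
    cases n with
    | zero => rfl
    | succ n =>
      exact commutator_of_mem_center _
        (mem_centralWords.mp (partialProd_mem_centralWords hw) n)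
  have hBc' := fun w => partialProd_inv_mem_centralWords (hBc (partialProd G w))
  refine ⟨(partialProd G)⁻¹ a, fun w => E w * (partialProd G)⁻¹ (B (partialProd G w)),
    fun w => mul_mem (hEc w) (hBc' w), fun v w => ?_, fun w hw => ?_, fun w => ?_⟩
  · have h : (partialProd G)⁻¹ (B (partialProd G (v * w))) =
        (partialProd G)⁻¹ (B (partialProd G v)) * (partialProd G)⁻¹ (B (partialProd G w)) := by
      rw [hBt, Equiv.Perm.inv_eq_iff_eq, partialProd_central_mul (hBc' v)]
      simp
    beta_reduce
    rw [h, hEm, mul_assoc, mul_assoc, ← mul_assoc (E w), ← mul_assoc _ (E w),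
      centralWords_comm (hEc w)]
  · beta_reduce
    rw [hE1 w hw, hBt1 w hw, one_mul, Equiv.Perm.inv_eq_iff_eq, partialProd_apply_one]
  · rw [Equiv.Perm.mul_apply, Equiv.Perm.mul_apply, hfB]
    funext n
    cases n with
    | zero =>
      simp only [partialProd_inv_apply_zero, Pi.mul_apply, hE0, partialProd_apply_zero, one_mul]
    | succ n =>
      simp only [partialProd_inv_apply_succ, Pi.mul_apply, hE, partialProd_apply_succ]
      set b := B (partialProd G w) n
      set x := partialProd G w n
      have hb : ∀ g, g * b⁻¹ = b⁻¹ * g := Subgroup.mem_center_iff.mp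
        (inv_mem (mem_centralWords.mp (hBc (partialProd G w)) n))
      have hc := Subgroup.mem_center_iff.mp
        (commutator_mem_center hG ((a n)⁻¹ * a (n + 1)) x) (w (n + 1))
      have h1 := hb (x⁻¹ * (a n)⁻¹ * a (n + 1) * x * w (n + 1))
      calc _ = b⁻¹ * (x⁻¹ * (a n)⁻¹ * a (n + 1) * x * w (n + 1)) *
            B (partialProd G w) (n + 1) := by group
        _ = ((a n)⁻¹ * a (n + 1)) * (((a n)⁻¹ * a (n + 1))⁻¹ * x⁻¹ * ((a n)⁻¹ * a (n + 1)) * x *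
              w (n + 1)) * (b⁻¹ * B (partialProd G w) (n + 1)) := by rw [← h1]; group
        _ = _ := by rw [← hc]; group

theorem isCentrallyTwisted_lamp_neg (hG : ∀ a b : G, a * b * a⁻¹ * b⁻¹ ∈ Subgroup.center G)
    (d : ℕ) (g : G) : IsCentrallyTwisted (lamp (-(d : ℤ)) g) := by
  induction d with
  | zero => simpa [lamp_zero] using isCentrallyTwisted_firstMul g
  | succ d ih => rw [lamp_neg_succ]; exact ih.conj hG

theorem IsCentrallyTwisted.commutator_mem
    (hG : ∀ a b : G, a * b * a⁻¹ * b⁻¹ ∈ Subgroup.center G)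
    {f : Equiv.Perm (ℕ → G)} (hf : IsCentrallyTwisted f) (h : G) :
    ⁅firstMul G h, f⁆ ∈ centralTranslations G := by
  obtain ⟨a, B, hBc, hBm, hB1, hfB⟩ := hf
  set u : ℕ → G := Pi.mulSingle 0 h with hu
  have hc : u * a * u⁻¹ * a⁻¹ ∈ centralWords G :=
    mem_centralWords.mpr fun n => hG (u n) (a n)
  refine mem_centralTranslations.mpr ⟨(u * a * u⁻¹ * a⁻¹) * (B u)⁻¹,
    mul_mem hc (inv_mem (hBc u)), fun w => ?_⟩
  -- On such a word the commutator returns `u * f v`, to be compared with `f (u * v) = a * (u * v) *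
  -- B u * B v`.
  obtain ⟨v, rfl⟩ : ∃ v, w = f (firstMul G h v) :=
    ⟨(firstMul G h)⁻¹ (f⁻¹ w), by simp⟩
  have h1 : ⁅firstMul G h, f⁆ (f (firstMul G h v)) = firstMul G h (f v) := by
    simp [commutatorElement_def]
  have h2 := centralWords_comm (inv_mem (hBc u)) (a * (u * v))
  rw [h1, firstMul_apply, firstMul_apply, ← hu, hfB, hfB, hBm]
  calc u * (a * v * B v) = (u * a * u⁻¹ * a⁻¹) * ((a * (u * v)) * (B u)⁻¹) * (B u * B v) := by group
    _ = _ := by rw [h2]; group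

theorem lamp_commutator_mem_lampSubgroup
    (hG : ∀ a b : G, a * b * a⁻¹ * b⁻¹ ∈ Subgroup.center G)
    {I : Set ℤ} [I.OrdConnected] {i j : ℤ} (hi : i ∈ I) (hj : j ∈ I) (g h : G) :
    ⁅lamp i g, lamp j h⁆ ∈ lampSubgroup (Subgroup.center G) I := by
  wlog hij : j ≤ i generalizing i j g h
  · have := inv_mem (this hj hi h g (by omega))
    rwa [commutatorElement_inv] at this
  -- Shifting indices by `-(j + d)` moves the pair to `0` and `-d`. Shifting back sends `[-d, 0]` to
  -- `[j, j + d]`, which lies in `I` by order-convexity.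
  obtain ⟨d, rfl⟩ := Int.exists_add_of_le hij
  have h1 : ⁅firstMul G g, lamp (-(d : ℤ)) h⁆ ∈
      lampSubgroup (Subgroup.center G) (Set.Icc (-(d : ℤ)) 0) := by
    refine mem_lampSubgroup_of_tailFixing ((isCentrallyTwisted_lamp_neg hG d h).commutator_mem hG g)
      ?_
    have hg := tailFixing_mono (Nat.zero_le d) (firstMul_mem_tailFixing g)
    have hh := lamp_neg_mem_tailFixing d h
    exact mul_mem (mul_mem (mul_mem hg hh) (inv_mem hg)) (inv_mem hh)
  have h2 := conj_mem_lampSubgroup (T := I) (j + d)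
    (fun k hk => Set.OrdConnected.out ‹I.OrdConnected› hj hi
      ⟨by have := hk.1; omega, by have := hk.2; omega⟩) h1
  have e1 := conj_lamp (j + d) 0 g
  have e2 := conj_lamp (j + d) (-(d : ℤ)) h
  rw [add_zero, lamp_zero] at e1
  rw [add_neg_cancel_right] at e2
  rwa [← e1, ← e2, ← conjugate_commutatorElement]

/-- Commutators of generators are central lamps products, which commute with everything here, so the
commutator is multiplicative in each entry and the generators suffice. -/
theorem commutator_mem_lampSubgroup (hG : ∀ a b : G, a * b * a⁻¹ * b⁻¹ ∈ Subgroup.center G)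
    {I : Set ℤ} [I.OrdConnected] {x y : Equiv.Perm (ℕ → G)}
    (hx : x ∈ lampSubgroup ⊤ I) (hy : y ∈ lampSubgroup ⊤ I) :
    ⁅x, y⁆ ∈ lampSubgroup (Subgroup.center G) I := by
  have hmul : ∀ {y : Equiv.Perm (ℕ → G)} (x x' : Equiv.Perm (ℕ → G)), x ∈ lampSubgroup ⊤ I → ⁅x, y⁆ ∈ lampSubgroup (Subgroup.center G) I →
      ⁅x', y⁆ ∈ lampSubgroup (Subgroup.center G) I →
      ⁅x * x', y⁆ ∈ lampSubgroup (Subgroup.center G) I := by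
    intro y x x' hx h h'
    have e := (commute_of_mem_lampSubgroup_center h' hx).eq
    have : ⁅x * x', y⁆ = ⁅x', y⁆ * ⁅x, y⁆ := by
      calc ⁅x * x', y⁆ = (x * ⁅x', y⁆) * x⁻¹ * ⁅x, y⁆ := by
            simp only [commutatorElement_def]; group
        _ = _ := by rw [← e]; group
    rw [this]
    exact mul_mem h' h
  have hinv : ∀ {y : Equiv.Perm (ℕ → G)} (x : Equiv.Perm (ℕ → G)), x ∈ lampSubgroup ⊤ I → ⁅x, y⁆ ∈ lampSubgroup (Subgroup.center G) I →
      ⁅x⁻¹, y⁆ ∈ lampSubgroup (Subgroup.center G) I := by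
    intro y x hx h
    have e := (commute_of_mem_lampSubgroup_center (inv_mem h) hx).eq
    have : ⁅x⁻¹, y⁆ = ⁅x, y⁆⁻¹ := by
      calc ⁅x⁻¹, y⁆ = x⁻¹ * (⁅x, y⁆⁻¹ * x) := by simp only [commutatorElement_def]; group
        _ = _ := by rw [e]; group
    rw [this]
    exact inv_mem h
  have hswap : ∀ {x y : Equiv.Perm (ℕ → G)}, ⁅x, y⁆ ∈ lampSubgroup (Subgroup.center G) I →
      ⁅y, x⁆ ∈ lampSubgroup (Subgroup.center G) I := by
    intro x y h
    rw [← commutatorElement_inv]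
    exact inv_mem h
  induction hx using Subgroup.closure_induction with
  | mem x hx =>
    obtain ⟨i, hi, g, -, rfl⟩ := hx
    apply hswap
    induction hy using Subgroup.closure_induction with
    | mem y hy =>
      obtain ⟨j, hj, h, -, rfl⟩ := hy
      exact lamp_commutator_mem_lampSubgroup hG hj hi h g
    | one => rw [commutatorElement_one_left]; exact one_mem _
    | mul y y' hy _ h h' => exact hmul y y' hy h h'
    | inv y hy h => exact hinv y hy h
  | one => rw [commutatorElement_one_left]; exact one_mem _
  | mul x x' hx _ h h' => exact hmul x x' hx h h'
  | inv x hx h => exact hinv x hx h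

/-! ### Sorting lamps by index, and uniqueness of the sorted form. -/

theorem exists_mul_of_mem_lampSubgroup_center {I J K : Set ℤ} (hIJK : I ⊆ J ∪ K)
    {c : Equiv.Perm (ℕ → G)} (hc : c ∈ lampSubgroup (Subgroup.center G) I) :
    ∃ a ∈ lampSubgroup (Subgroup.center G) J, ∃ b ∈ lampSubgroup (Subgroup.center G) K,
      c = a * b := by
  induction hc using Subgroup.closure_induction with
  | mem x hx =>
    obtain ⟨i, hi, g, hg, rfl⟩ := hx
    rcases hIJK hi with h | h
    · exact ⟨_, lamp_mem_lampSubgroup h hg, 1, one_mem _, (mul_one _).symm⟩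
    · exact ⟨1, one_mem _, _, lamp_mem_lampSubgroup h hg, (one_mul _).symm⟩
  | one => exact ⟨1, one_mem _, 1, one_mem _, (mul_one _).symm⟩
  | mul x y _ _ hx hy =>
    obtain ⟨a, ha, b, hb, rfl⟩ := hx
    obtain ⟨a', ha', b', hb', rfl⟩ := hy
    exact ⟨a * a', mul_mem ha ha', b * b', mul_mem hb hb',
      (commute_of_mem_lampSubgroup_center hb ha').mul_mul_mul_comm a b'⟩
  | inv x _ hx =>
    obtain ⟨a, ha, b, hb, rfl⟩ := hx
    refine ⟨a⁻¹, inv_mem ha, b⁻¹, inv_mem hb, ?_⟩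
    rw [(commute_of_mem_lampSubgroup_center ha hb).eq, mul_inv_rev]

/-- To interchange `b` and `a`, split the central commutator `⁅b, a⁆ = c * d` along `J` and `K`;
then `b * a = (c * a) * (d * b)`. -/
theorem exists_mul_of_mem_lampSubgroup (hG : ∀ a b : G, a * b * a⁻¹ * b⁻¹ ∈ Subgroup.center G)
    {I J K : Set ℤ} [I.OrdConnected] (hIJK : I ⊆ J ∪ K) (hJ : J ⊆ I) (hK : K ⊆ I)
    {x : Equiv.Perm (ℕ → G)} (hx : x ∈ lampSubgroup ⊤ I) :
    ∃ a ∈ lampSubgroup ⊤ J, ∃ b ∈ lampSubgroup ⊤ K, x = a * b := by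
  have hle : ∀ S : Set ℤ, lampSubgroup (Subgroup.center G) S ≤ lampSubgroup ⊤ S :=
    fun S => lampSubgroup_mono le_top le_rfl
  have hcomm : ∀ a ∈ lampSubgroup (⊤ : Subgroup G) J, ∀ b ∈ lampSubgroup (⊤ : Subgroup G) K,
      ∃ c ∈ lampSubgroup (⊤ : Subgroup G) J, ∃ d ∈ lampSubgroup (⊤ : Subgroup G) K,
        b * a = c * d := by
    intro a ha b hb
    obtain ⟨c, hc, d, hd, hcd⟩ := exists_mul_of_mem_lampSubgroup_center hIJK
      (commutator_mem_lampSubgroup hG (lampSubgroup_mono le_rfl hK hb)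
        (lampSubgroup_mono le_rfl hJ ha))
    refine ⟨c * a, mul_mem (hle _ hc) ha, d * b, mul_mem (hle _ hd) hb, ?_⟩
    have e := (commute_of_mem_lampSubgroup_center hd ha).eq
    calc b * a = ⁅b, a⁆ * (a * b) := by rw [commutatorElement_def]; group
      _ = c * (d * a) * b := by rw [hcd]; group
      _ = _ := by rw [e]; group
  induction hx using Subgroup.closure_induction with
  | mem x hx =>
    obtain ⟨i, hi, g, hg, rfl⟩ := hx
    rcases hIJK hi with h | h
    · exact ⟨_, lamp_mem_lampSubgroup h hg, 1, one_mem _, (mul_one _).symm⟩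
    · exact ⟨1, one_mem _, _, lamp_mem_lampSubgroup h hg, (one_mul _).symm⟩
  | one => exact ⟨1, one_mem _, 1, one_mem _, (mul_one _).symm⟩
  | mul x y _ _ hx hy =>
    obtain ⟨a, ha, b, hb, rfl⟩ := hx
    obtain ⟨a', ha', b', hb', rfl⟩ := hy
    obtain ⟨c, hc, d, hd, h⟩ := hcomm a' ha' b hb
    refine ⟨a * c, mul_mem ha hc, d * b', mul_mem hd hb', ?_⟩
    rw [mul_assoc, ← mul_assoc b, h]
    group
  | inv x _ hx =>
    obtain ⟨a, ha, b, hb, rfl⟩ := hx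
    rw [mul_inv_rev]
    exact hcomm _ (inv_mem ha) _ (inv_mem hb)

theorem exists_lamp_of_mem_lampSubgroup_singleton {k : ℤ} {x : Equiv.Perm (ℕ → G)}
    (hx : x ∈ lampSubgroup ⊤ {k}) : ∃ g : G, x = lamp k g := by
  induction hx using Subgroup.closure_induction with
  | mem x hx =>
    obtain ⟨i, rfl, g, -, rfl⟩ := hx
    exact ⟨g, rfl⟩
  | one => exact ⟨1, (lamp_one k).symm⟩
  | mul x y _ _ hx hy =>
    obtain ⟨g, rfl⟩ := hx
    obtain ⟨h, rfl⟩ := hy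
    exact ⟨g * h, (lamp_mul k g h).symm⟩
  | inv x _ hx =>
    obtain ⟨g, rfl⟩ := hx
    exact ⟨g⁻¹, (lamp_inv k g).symm⟩

theorem lampSubgroup_Icc_le_tailFixing (d : ℕ) :
    lampSubgroup (⊤ : Subgroup G) (Set.Icc (-(d : ℤ)) 0) ≤ tailFixing G d := by
  refine lampSubgroup_le.mpr fun k hk g _ => ?_
  obtain ⟨hk1, hk2⟩ := hk
  obtain ⟨n, rfl⟩ : ∃ n : ℕ, k = -(n : ℤ) := ⟨(-k).toNat, by omega⟩
  exact tailFixing_mono (by omega) (lamp_neg_mem_tailFixing n g)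

theorem eq_one_of_lamp_mem_Ioi {j : ℤ} {g : G} (h : lamp j g ∈ lampSubgroup ⊤ (Set.Ioi j)) :
    g = 1 := by
  obtain ⟨m, hm⟩ := exists_mem_lampSubgroup_inter_Icc h
  obtain ⟨d, hd⟩ : ∃ d : ℕ, (m : ℤ) ≤ j + (d + 1) := ⟨(m - j).toNat, by omega⟩
  -- After this shift the subgroup fixes letter `d + 1`, whereas the lamp, now of index `-(d + 1)`,
  -- puts `g` or `g⁻¹` there in the trivial word.
  have h1 := conj_mem_lampSubgroup (T := Set.Icc (-(d : ℤ)) 0) (-(j + (d + 1)))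
    (fun k hk => by
      obtain ⟨hk1, hk2, hk3⟩ := hk
      rw [Set.mem_Ioi] at hk1
      constructor <;> omega) hm
  rw [conj_lamp, show -(j + ((d : ℤ) + 1)) + j = -((d + 1 : ℕ) : ℤ) by push_cast; ring] at h1
  have h2 := lampSubgroup_Icc_le_tailFixing d h1 1 (d + 1) (by omega)
  rw [(lamp_neg_apply_one_support (d + 1) g).2] at h2
  have h3 : (g ^ ((-1 : ℤ) ^ (d + 1))) ^ ((-1 : ℤ) ^ (d + 1)) = 1 := by rw [h2]; simp
  rw [← zpow_mul, ← mul_pow] at h3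
  simpa using h3

theorem eq_one_of_mem_Ioi_of_mem_Iic (hG : ∀ a b : G, a * b * a⁻¹ * b⁻¹ ∈ Subgroup.center G)
    {n : ℤ} {x : Equiv.Perm (ℕ → G)} (hx : x ∈ lampSubgroup ⊤ (Set.Ioi n))
    (hx' : x ∈ lampSubgroup ⊤ (Set.Iic n)) : x = 1 := by
  -- The lowest lamp of `x` is split off on the right; since `x` also lies above `n`, that lamp lies
  -- in the subgroup of strictly higher indices and is trivial.
  have key : ∀ d : ℕ, x ∈ lampSubgroup ⊤ (Set.Ioc (n - d) n) → x = 1 := by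
    intro d
    induction d with
    | zero =>
      intro h
      have h2 : x ∈ (⊥ : Subgroup _) := (lampSubgroup_le.mpr fun k hk => by
        obtain ⟨hk1, hk2⟩ := hk
        push_cast at hk1
        omega) h
      exact Subgroup.mem_bot.mp h2
    | succ d ih =>
      intro h
      obtain ⟨a, ha, b, hb, hab⟩ := exists_mul_of_mem_lampSubgroup hG
        (J := Set.Ioc (n - d) n) (K := {n - d})
        (I := Set.Icc (n - d) n) (fun k hk => by
          obtain ⟨hk1, hk2⟩ := hk
          rcases hk1.eq_or_lt with h | h
          · exact Or.inr h.symm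
          · exact Or.inl ⟨h, hk2⟩) Set.Ioc_subset_Icc_self (by simp)
        (lampSubgroup_mono le_rfl (fun k hk => by
          obtain ⟨hk1, hk2⟩ := hk
          push_cast at hk1
          constructor <;> omega) h)
      obtain ⟨g, rfl⟩ := exists_lamp_of_mem_lampSubgroup_singleton hb
      have hg : lamp (n - d) g ∈ lampSubgroup ⊤ (Set.Ioi (n - (d : ℤ))) := by
        have e : lamp (n - d) g = a⁻¹ * x := by rw [hab, inv_mul_cancel_left]
        rw [e]
        exact mul_mem (inv_mem (lampSubgroup_mono le_rfl (fun k hk => hk.1) ha))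
          (lampSubgroup_mono le_rfl (Set.Ioi_subset_Ioi (by omega)) hx)
      rw [eq_one_of_lamp_mem_Ioi hg, lamp_one, mul_one] at hab
      exact ih (hab ▸ ha)
  obtain ⟨m, hm⟩ := exists_mem_lampSubgroup_inter_Icc hx'
  refine key (n + m + 1).toNat (lampSubgroup_mono le_rfl (fun k hk => ?_) hm)
  obtain ⟨hk1, hk2, hk3⟩ := hk
  rw [Set.mem_Iic] at hk1
  constructor <;> omega

theorem eq_one_of_lamp_mem_Iio (hG : ∀ a b : G, a * b * a⁻¹ * b⁻¹ ∈ Subgroup.center G)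
    {j : ℤ} {g : G} (h : lamp j g ∈ lampSubgroup ⊤ (Set.Iio j)) : g = 1 := by
  refine lamp_injective j ((eq_one_of_mem_Ioi_of_mem_Iic hG (n := j - 1)
    (lamp_mem_lampSubgroup (by simp) trivial)
    (lampSubgroup_mono le_rfl (fun k hk => ?_) h)).trans (lamp_one j).symm)
  rw [Set.mem_Iio] at hk
  rw [Set.mem_Iic]
  omega

/-- A product of finitely many lamps, conjugated to indices `≤ 0`, fixes all far letters, while a
nontrivial power of `(partialProd G)⁻¹` moves the end of any finite support. -/
theorem partialProd_zpow_mem_lampSubgroup [Nontrivial G] {n : ℤ}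
    (h : partialProd G ^ n ∈ lampSubgroup ⊤ Set.univ) : n = 0 := by
  obtain ⟨m, hm⟩ := exists_mem_lampSubgroup_inter_Icc h
  have h1 := conj_mem_lampSubgroup (T := Set.Icc (-((2 * m : ℕ) : ℤ)) 0) (-(m : ℤ))
    (fun k hk => by
      obtain ⟨-, hk2, hk3⟩ := hk
      constructor <;> push_cast <;> omega) hm
  rw [← zpow_neg, ← zpow_add, ← zpow_add, show -(m : ℤ) + n + - -(m : ℤ) = n by ring] at h1
  have h2 := lampSubgroup_Icc_le_tailFixing _ h1
  have key : ∀ k : ℕ, (partialProd G)⁻¹ ^ k ∈ tailFixing G (2 * m) → k = 0 := by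
    intro k hk
    by_contra hk0
    obtain ⟨g, hg⟩ := exists_ne (1 : G)
    have h3 := (partialProd_inv_pow_support k (2 * m + 1) (Pi.mulSingle (2 * m + 1) g)
      (fun n hn => by rw [Pi.mulSingle_eq_of_ne hn.ne'])).2
    rw [hk _ _ (by omega), Pi.mulSingle_eq_of_ne (by omega), Pi.mulSingle_eq_same] at h3
    have h4 : (g ^ ((-1 : ℤ) ^ k)) ^ ((-1 : ℤ) ^ k) = 1 := by rw [← h3]; simp
    rw [← zpow_mul, ← mul_pow] at h4
    exact hg (by simpa using h4)
  rcases Int.eq_nat_or_neg n with ⟨k, rfl | rfl⟩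
  · have h3 := inv_mem h2
    rw [zpow_natCast, ← inv_pow] at h3
    rw [key k h3]
    rfl
  · rw [zpow_neg, zpow_natCast, ← inv_pow] at h2
    rw [key k h2]
    rfl

end ClassTwo

/-! ### The level homomorphism and the conclusion. -/

section AutomataGroup

variable {G : Type*} [Group G]

theorem partialProd_mem_automataGroup : partialProd G ∈ (cayleyMachine G).automataGroup :=
  Subgroup.subset_closure ⟨1, rfl⟩

theorem lamp_mem_automataGroup (k : ℤ) (g : G) : lamp k g ∈ (cayleyMachine G).automataGroup := by
  have hg : firstMul G g ∈ (cayleyMachine G).automataGroup := by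
    have h : (cayleyMachine G).statePerm g ∈ (cayleyMachine G).automataGroup :=
      Subgroup.subset_closure ⟨g, rfl⟩
    rw [statePerm_cayleyMachine] at h
    simpa using mul_mem (inv_mem partialProd_mem_automataGroup) h
  have ht := zpow_mem (partialProd_mem_automataGroup (G := G)) k
  exact mul_mem (mul_mem ht hg) (inv_mem ht)

theorem exists_mul_zpow_of_mem_automataGroup {x : Equiv.Perm (ℕ → G)}
    (hx : x ∈ (cayleyMachine G).automataGroup) :
    ∃ n : ℤ, x * (partialProd G ^ n)⁻¹ ∈ lampSubgroup ⊤ Set.univ := by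
  have hconj : ∀ (n : ℤ) {y : Equiv.Perm (ℕ → G)}, y ∈ lampSubgroup ⊤ Set.univ →
      partialProd G ^ n * y * (partialProd G ^ n)⁻¹ ∈ lampSubgroup ⊤ Set.univ :=
    fun n y hy => conj_mem_lampSubgroup n (fun _ _ => Set.mem_univ _) hy
  induction hx using Subgroup.closure_induction with
  | mem x hx =>
    obtain ⟨g, rfl⟩ := hx
    refine ⟨1, ?_⟩
    rw [statePerm_cayleyMachine]
    -- The generator of state `g` equals `lamp 1 g * partialProd G`.
    have h : lamp 1 g ∈ lampSubgroup ⊤ Set.univ := lamp_mem_lampSubgroup trivial trivial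
    simpa [lamp] using h
  | one => exact ⟨0, by simp⟩
  | mul x y _ _ hx hy =>
    obtain ⟨m, hm⟩ := hx
    obtain ⟨n, hn⟩ := hy
    refine ⟨m + n, ?_⟩
    have h := mul_mem hm (hconj m hn)
    rw [zpow_add]
    simpa [mul_assoc] using h
  | inv x _ hx =>
    obtain ⟨m, hm⟩ := hx
    refine ⟨-m, ?_⟩
    have h := hconj (-m) (inv_mem hm)
    simpa [mul_assoc] using h

theorem exists_level [Nontrivial G] :
    ∃ lev : (cayleyMachine G).automataGroup →* Multiplicative ℤ,
      lev ⟨partialProd G, partialProd_mem_automataGroup⟩ = Multiplicative.ofAdd 1 ∧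
      ∀ γ, γ ∈ lev.ker ↔ (γ : Equiv.Perm (ℕ → G)) ∈ lampSubgroup ⊤ Set.univ := by
  choose lev hlev using fun γ : (cayleyMachine G).automataGroup =>
    exists_mul_zpow_of_mem_automataGroup γ.2
  have huniq : ∀ (γ : (cayleyMachine G).automataGroup) (n : ℤ),
      (γ : Equiv.Perm (ℕ → G)) * (partialProd G ^ n)⁻¹ ∈ lampSubgroup ⊤ Set.univ → lev γ = n := by
    intro γ n hn
    have h := mul_mem (inv_mem hn) (hlev γ)
    have e : ((γ : Equiv.Perm (ℕ → G)) * (partialProd G ^ n)⁻¹)⁻¹ *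
        (γ * (partialProd G ^ lev γ)⁻¹) = partialProd G ^ (n - lev γ) := by
      rw [zpow_sub]
      group
    rw [e] at h
    have := partialProd_zpow_mem_lampSubgroup h
    omega
  have hmul : ∀ γ δ, lev (γ * δ) = lev γ + lev δ := by
    intro γ δ
    refine huniq _ _ ?_
    have h := mul_mem (hlev γ) (conj_mem_lampSubgroup (T := Set.univ) (lev γ)
      (fun _ _ => trivial) (hlev δ))
    rw [zpow_add]
    simpa [mul_assoc] using h
  refine ⟨MonoidHom.mk' (fun γ => Multiplicative.ofAdd (lev γ))
    (fun γ δ => congrArg Multiplicative.ofAdd (hmul γ δ)),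
    congrArg Multiplicative.ofAdd (huniq _ 1 (by simp)), fun γ => ?_⟩
  change lev γ = 0 ↔ _
  constructor
  · intro h
    have h1 := hlev γ
    rw [h] at h1
    simpa using h1
  · intro h
    exact huniq γ 0 (by simpa using h)

theorem commutator_mem_center_of_nilpotencyClass_le_two [Group.IsNilpotent G]
    (hG : Group.nilpotencyClass G ≤ 2) (a b : G) : a * b * a⁻¹ * b⁻¹ ∈ Subgroup.center G := by
  have h : Subgroup.upperCentralSeries G 2 = ⊤ :=
    top_le_iff.mp (Subgroup.upperCentralSeries_nilpotencyClass (G := G) ▸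
      Subgroup.upperCentralSeries_mono G hG)
  have ha : a ∈ Subgroup.upperCentralSeries G (1 + 1) := h ▸ Subgroup.mem_top a
  rw [← Subgroup.upperCentralSeries_one]
  exact Subgroup.mem_upperCentralSeries_succ_iff.mp ha b

end AutomataGroup

theorem theorem2 (G : Type*) [Group G] [Finite G] [Nontrivial G] [Group.IsNilpotent G]
    (hG : Group.nilpotencyClass G ≤ 2) :
    IsCrossWiredLamplighter (cayleyMachine G).automataGroup := by
  have hc := commutator_mem_center_of_nilpotencyClass_le_two hG
  obtain ⟨lev, hlev, hker⟩ := exists_level (G := G)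
  have hup : ∀ (n : ℤ) {S T : Set ℤ} {x : Equiv.Perm (ℕ → G)}, (∀ k ∈ S, n + k ∈ T) →
      x ∈ lampSubgroup ⊤ S →
      partialProd G ^ n * x * (partialProd G ^ n)⁻¹ ∈ lampSubgroup ⊤ T :=
    fun n _ _ _ h hx => conj_mem_lampSubgroup n h hx
  refine isCrossWiredLamplighter_of_complement (G := G) lev _ hlev
    ((lampSubgroup ⊤ (Set.Ici 0)).subgroupOf _) ((lampSubgroup ⊤ (Set.Iio 0)).subgroupOf _)
    (fun γ hγ => (hker γ).mpr (lampSubgroup_mono le_rfl (Set.subset_univ _) hγ))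
    (fun γ hγ => (hker γ).mpr (lampSubgroup_mono le_rfl (Set.subset_univ _) hγ))
    (fun γ hγ => ?_) (fun γ hγ => ?_)
    -- The transversals are the lamps at the boundary index lost under contraction: `0` for indices
    -- `≥ 0`, and `-1` for indices `< 0`.
    (fun g => ⟨lamp 0 g, lamp_mem_automataGroup 0 g⟩)
    (fun g => ⟨lamp (-1) g, lamp_mem_automataGroup (-1) g⟩)
    (fun g => lamp_mem_lampSubgroup (by simp) trivial)
    (fun g => lamp_mem_lampSubgroup (by simp) trivial)
    (fun g g' h => ?_) (fun g g' h => ?_) (fun γ hγ => ?_) (fun γ hγ => ?_)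
    (fun γ hγ => ?_) (fun γ hγ => ?_) (fun γ hγ hγ' => ?_) (fun γ hγ => ?_)
  · have h := hup 1 (T := Set.Ici 0) (fun k hk => by
      rw [Set.mem_Ici] at hk ⊢
      omega) (Subgroup.mem_subgroupOf.mp hγ)
    simpa [Subgroup.mem_subgroupOf] using h
  · have h := hup (-1) (T := Set.Iio 0) (fun k hk => by
      rw [Set.mem_Iio] at hk ⊢
      omega) (Subgroup.mem_subgroupOf.mp hγ)
    simpa [Subgroup.mem_subgroupOf] using h
  · have h1 := hup 1 (T := Set.Ioi 0) (fun k hk => by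
      rw [Set.mem_Ici] at hk
      rw [Set.mem_Ioi]
      omega) (Subgroup.mem_subgroupOf.mp h)
    have h2 : lamp 0 (g⁻¹ * g') ∈ lampSubgroup ⊤ (Set.Ioi 0) := by
      rw [lamp_mul, lamp_inv]
      simpa [mul_assoc] using h1
    exact inv_mul_eq_one.mp (eq_one_of_lamp_mem_Ioi h2)
  · have h1 := hup (-1) (T := Set.Iio (-1)) (fun k hk => by
      rw [Set.mem_Iio] at hk ⊢
      omega) (Subgroup.mem_subgroupOf.mp h)
    have h2 : lamp (-1) (g⁻¹ * g') ∈ lampSubgroup ⊤ (Set.Iio (-1)) := by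
      rw [lamp_mul, lamp_inv]
      simpa [mul_assoc] using h1
    exact inv_mul_eq_one.mp (eq_one_of_lamp_mem_Iio hc h2)
  · obtain ⟨a, ha, b, hb, hab⟩ := exists_mul_of_mem_lampSubgroup hc (J := {0}) (K := Set.Ioi 0)
      (fun k hk => by
        rcases (Set.mem_Ici.mp hk).eq_or_lt with h | h
        · exact Or.inl h.symm
        · exact Or.inr h) (by simp) Set.Ioi_subset_Ici_self (Subgroup.mem_subgroupOf.mp hγ)
    obtain ⟨g, rfl⟩ := exists_lamp_of_mem_lampSubgroup_singleton ha
    refine ⟨g, ?_⟩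
    have h := hup (-1) (T := Set.Ici 0) (fun k hk => by
      rw [Set.mem_Ioi] at hk
      rw [Set.mem_Ici]
      omega) hb
    simpa [Subgroup.mem_subgroupOf, hab] using h
  · obtain ⟨a, ha, b, hb, hab⟩ := exists_mul_of_mem_lampSubgroup hc (J := {-1}) (K := Set.Iio (-1))
      (fun k hk => by
        rw [Set.mem_Iio] at hk
        rcases (show k ≤ -1 by omega).eq_or_lt with h | h
        · exact Or.inl h
        · exact Or.inr h) (by simp) (Set.Iio_subset_Iio (by norm_num))
      (Subgroup.mem_subgroupOf.mp hγ)
    obtain ⟨g, rfl⟩ := exists_lamp_of_mem_lampSubgroup_singleton ha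
    refine ⟨g, ?_⟩
    have h := hup 1 (T := Set.Iio 0) (fun k hk => by
      rw [Set.mem_Iio] at hk ⊢
      omega) hb
    simpa [Subgroup.mem_subgroupOf, hab] using h
  · obtain ⟨m, hm⟩ := exists_mem_lampSubgroup_inter_Icc ((hker γ).mp hγ)
    refine ⟨m, ?_⟩
    have h := hup m (T := Set.Ici 0) (fun k hk => by
      have := hk.2.1
      rw [Set.mem_Ici]
      omega) hm
    simpa [Subgroup.mem_subgroupOf] using h
  · obtain ⟨m, hm⟩ := exists_mem_lampSubgroup_inter_Icc ((hker γ).mp hγ)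
    refine ⟨m + 1, ?_⟩
    have h := hup (-((m + 1 : ℕ) : ℤ)) (T := Set.Iio 0) (fun k hk => by
      have := hk.2.2
      rw [Set.mem_Iio]
      push_cast
      omega) hm
    rw [zpow_neg, zpow_natCast, inv_inv] at h
    exact h
  · exact Subtype.ext (eq_one_of_mem_Ioi_of_mem_Iic hc (n := -1)
      (lampSubgroup_mono le_rfl (fun k hk => by
        rw [Set.mem_Ici] at hk
        rw [Set.mem_Ioi]
        omega) hγ)
      (lampSubgroup_mono le_rfl (fun k hk => by
        rw [Set.mem_Iio] at hk
        rw [Set.mem_Iic]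
        omega) hγ'))
  · obtain ⟨a, ha, b, hb, hab⟩ := exists_mul_of_mem_lampSubgroup hc (J := Set.Ici 0)
      (K := Set.Iio 0) (fun k _ => le_or_gt 0 k) (Set.subset_univ _) (Set.subset_univ _)
      ((hker γ).mp hγ)
    have hle : ∀ S : Set ℤ, lampSubgroup ⊤ S ≤ (cayleyMachine G).automataGroup :=
      fun S => lampSubgroup_le.mpr fun k _ g _ => lamp_mem_automataGroup k g
    exact ⟨⟨a, hle _ ha⟩, ha, ⟨b, hle _ hb⟩, hb, Subtype.ext hab⟩
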